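/- Let $G=(V,E)$ be a connected, locally finite (finite or infinite) graph with a symmetric edge weight $\mu:V\times V\to[0,\infty)$ such that $\mu_{xy}>0$ if and only if $x\sim y$ and $\inf_{x\sim y}\mu_{xy}>0$, and let $m:V\to(0,\infty)$ be a vertex measure. Put $\deg(x)=\sum_{y}\mu_{xy}$ and assume $D_m=\sup_{x\in V}\deg(x)/m(x)<\infty$. For $f:V\to\mathbb R$ let $$\Delta f(x)=\frac1{m(x)}\sum_{y\in V}\mu_{xy}\,(f(y)-f(x)),$$ $$\Gamma(f,g)=\tfrac12\big(\Delta(fg)-f\Delta g-g\Delta f\big),\qquad \Gamma_2(f,g)=\tfrac12\big(\Delta\Gamma(f,g)-\Gamma(f,\Delta g)-\Gamma(\Delta f,g)\big),$$ and write $\Gamma(f)=\Gamma(f,f)$, $\Gamma_2(f)=\Gamma_2(f,f)$. The graph satisfies the exponential curvature dimension inequality $CDE(n,K')$ if for every vertex $x\in V$ and every positive function $f:V\to(0,\infty)$ with $\Delta f(x)<0$, $$\Gamma_2(f)(x)-\Gamma\Big(f,\frac{\Gamma(f)}{f}\Big)(x)\;\ge\;\frac1n(\Delta f(x))^2+K'\,\Gamma(f)(x).$$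 Theorem (Cheng's eigenvalue estimate on graphs). Let $n>0$ and $K\ge 0$ be real numbers and suppose that $G$ satisfies $CDE(n,-K)$. Let $\mu$ be the greatest lower bound of the $\ell^2$-spectrum of the graph Laplacian, that is, of the spectrum of the bounded self-adjoint operator $-\Delta$ on the Hilbert space $\ell^2(V,m)=\{f:V\to\mathbb R:\sum_x f(x)^2m(x)<\infty\}$ with inner product $\sum_x f(x)g(x)m(x)$. Then $$\mu\le Kn.$$ -/

import Mathlib

/-- A connected, locally finite graph on the vertex set `V` with a symmetric edge weight
`μ : V × V → [0, ∞)` which is positive exactly on edges and bounded below by a positive constant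
on the edges, and with a positive vertex measure `m`. -/
structure WeightedGraph (V : Type*) where
  graph : SimpleGraph V
  connected : graph.Connected
  finite_neighborSet : ∀ x, (graph.neighborSet x).Finite
  μ : V → V → ℝ
  μ_nonneg : ∀ x y, 0 ≤ μ x y
  μ_symm : ∀ x y, μ x y = μ y x
  μ_pos_iff : ∀ x y, 0 < μ x y ↔ graph.Adj x y
  μ_bddBelow : ∃ c : ℝ, 0 < c ∧ ∀ x y, graph.Adj x y → c ≤ μ x y
  m : V → ℝ
  m_pos : ∀ x, 0 < m x

namespace WeightedGraph

noncomputable section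

variable {V : Type*} (G : WeightedGraph V)

/-- The weighted degree. The sum has only finitely many nonzero terms. -/
def deg (x : V) : ℝ := ∑' y, G.μ x y

/-- The graph Laplacian `Δ` on all real functions on `V`. The sum has only finitely many
nonzero terms. -/
def laplacian (f : V → ℝ) (x : V) : ℝ := (1 / G.m x) * ∑' y, G.μ x y * (f y - f x)

/-- The gradient form `Γ(f, g)`. -/
def gradForm (f g : V → ℝ) (x : V) : ℝ :=
  (1 / 2) * (G.laplacian (fun y => f y * g y) x - f x * G.laplacian g x - G.laplacian f x * g x)

/-- The iterated gradient form `Γ₂(f, g)`. -/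
def gradForm₂ (f g : V → ℝ) (x : V) : ℝ :=
  (1 / 2) * (G.laplacian (G.gradForm f g) x - G.gradForm f (G.laplacian g) x
    - G.gradForm (G.laplacian f) g x)

/-- The exponential curvature dimension inequality `CDE(n, K)`. -/
def CDE (n K : ℝ) : Prop :=
  ∀ (x : V) (f : V → ℝ), (∀ y, 0 < f y) → G.laplacian f x < 0 →
    (1 / n) * (G.laplacian f x) ^ 2 + K * G.gradForm f f x ≤
      G.gradForm₂ f f x - G.gradForm f (fun y => G.gradForm f f y / f y) x

/-- `D_m = sup_x deg(x) / m(x)` is finite. -/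
def FiniteDm : Prop := BddAbove (Set.range fun x => G.deg x / G.m x)

/-! ### The Hilbert space `ℓ²(V, m)` -/

/-- The space `ℓ²(V, m)` of real functions `f` with `∑ |f(x)|² m(x) < ∞`, as a subspace of the
space of all real functions on `V`. -/
def ell2Submodule : Submodule ℝ (V → ℝ) where
  carrier := {f | Summable fun x => f x ^ 2 * G.m x}
  zero_mem' := by simp
  add_mem' := by
    intro f g hf hg
    refine Summable.of_nonneg_of_le (fun x => mul_nonneg (sq_nonneg _) (G.m_pos x).le)
      (fun x => ?_) ((hf.add hg).mul_left 2)
    have h := mul_nonneg (sq_nonneg (f x - g x)) (G.m_pos x).le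
    simp only [Pi.add_apply]
    nlinarith
  smul_mem' := by
    intro c f hf
    have h := Summable.mul_left (c ^ 2) hf
    refine h.congr fun x => ?_
    simp only [Pi.smul_apply, smul_eq_mul]
    ring

/-- The space `ℓ²(V, m)` as a type of its own. It is not reducible to the subspace, so that it
carries the topology of the `ℓ²`-norm below and not that of pointwise convergence. -/
def ell2 : Type _ := G.ell2Submodule

instance : AddCommGroup G.ell2 := inferInstanceAs (AddCommGroup G.ell2Submodule)

instance : Module ℝ G.ell2 := inferInstanceAs (Module ℝ G.ell2Submodule)

instance : CoeOut G.ell2 (V → ℝ) := ⟨fun f => f.1⟩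

theorem ell2_coe_add (f g : G.ell2) : ((f + g : G.ell2) : V → ℝ) = (f : V → ℝ) + g := rfl

theorem ell2_coe_smul (c : ℝ) (f : G.ell2) : ((c • f : G.ell2) : V → ℝ) = c • (f : V → ℝ) := rfl

theorem summable_sq (f : G.ell2) : Summable fun x => (f : V → ℝ) x ^ 2 * G.m x := f.2

theorem summable_mul (f g : G.ell2) :
    Summable fun x => (f : V → ℝ) x * (g : V → ℝ) x * G.m x := by
  refine Summable.of_norm_bounded ((G.summable_sq f).add (G.summable_sq g)) fun x => ?_
  have hm := (G.m_pos x).le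
  have h1 := mul_nonneg (sq_nonneg ((f : V → ℝ) x - (g : V → ℝ) x)) hm
  have h2 := mul_nonneg (sq_nonneg ((f : V → ℝ) x + (g : V → ℝ) x)) hm
  have h3 := mul_nonneg (sq_nonneg ((f : V → ℝ) x)) hm
  have h4 := mul_nonneg (sq_nonneg ((g : V → ℝ) x)) hm
  rw [Real.norm_eq_abs, abs_le]
  constructor <;> nlinarith

/-- The inner product `(f, g) = ∑ f(x) g(x) m(x)` on `ℓ²(V, m)`. -/
@[reducible]
def ell2Core : InnerProductSpace.Core ℝ G.ell2 where
  inner f g := ∑' x, (f : V → ℝ) x * (g : V → ℝ) x * G.m x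
  conj_inner_symm f g := by
    simp only [conj_trivial]
    exact tsum_congr fun x => by ring
  re_inner_nonneg f := by
    simp only [RCLike.re_to_real]
    exact tsum_nonneg fun x => mul_nonneg (mul_self_nonneg _) (G.m_pos x).le
  add_left f g h := by
    rw [← (G.summable_mul f h).tsum_add (G.summable_mul g h)]
    refine tsum_congr fun x => ?_
    simp only [ell2_coe_add, Pi.add_apply]
    ring
  smul_left f g r := by
    simp only [conj_trivial]
    rw [← tsum_mul_left]
    refine tsum_congr fun x => ?_
    simp only [ell2_coe_smul, Pi.smul_apply, smul_eq_mul]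
    ring
  definite f hf := by
    have h0 : ∀ x, 0 ≤ (f : V → ℝ) x * (f : V → ℝ) x * G.m x :=
      fun x => mul_nonneg (mul_self_nonneg _) (G.m_pos x).le
    have h1 := (hasSum_zero_iff_of_nonneg h0).1 (hf ▸ (G.summable_mul f f).hasSum)
    refine Subtype.ext (funext fun x => ?_)
    have h2 := congrFun h1 x
    simp only [Pi.zero_apply, mul_eq_zero, (G.m_pos x).ne', or_false, or_self] at h2
    exact h2

instance : NormedAddCommGroup G.ell2 := G.ell2Core.toNormedAddCommGroup

instance : InnerProductSpace ℝ G.ell2 := InnerProductSpace.ofCore G.ell2Core.toCore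

theorem norm_sq_ell2 (f : G.ell2) : ‖f‖ ^ 2 = ∑' x, (f : V → ℝ) x ^ 2 * G.m x := by
  rw [← real_inner_self_eq_norm_sq]
  exact tsum_congr fun x => by ring

/-! ### The Laplacian as a bounded operator on `ℓ²(V, m)` -/

theorem support_μ_finite (x : V) : (Function.support (G.μ x)).Finite := by
  refine (G.finite_neighborSet x).subset fun y hy => ?_
  exact (G.μ_pos_iff x y).1 (lt_of_le_of_ne (G.μ_nonneg x y) (Ne.symm hy))

theorem summable_μ_mul (x : V) (h : V → ℝ) : Summable fun y => G.μ x y * h y :=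
  summable_of_hasFiniteSupport
    ((G.support_μ_finite x).subset (Function.support_mul_subset_left _ _))

theorem summable_μ (x : V) : Summable (G.μ x) := summable_of_hasFiniteSupport (G.support_μ_finite x)

theorem deg_nonneg (x : V) : 0 ≤ G.deg x := tsum_nonneg (G.μ_nonneg x)

theorem sq_laplacian_le (f : V → ℝ) (x : V) :
    G.laplacian f x ^ 2 * G.m x ≤
      G.deg x / G.m x * (2 * ∑' y, (G.μ x y * f x ^ 2 + G.μ x y * f y ^ 2)) := by
  classical
  set s := (G.support_μ_finite x).toFinset with hs
  have hz : ∀ y, y ∉ s → G.μ x y = 0 := fun y hy => by simpa [hs] using hy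
  have e1 : ∑' y, G.μ x y * (f y - f x) = ∑ y ∈ s, G.μ x y * (f y - f x) :=
    tsum_eq_sum fun y hy => by rw [hz y hy, zero_mul]
  have e2 : G.deg x = ∑ y ∈ s, G.μ x y := tsum_eq_sum fun y hy => hz y hy
  have e3 : ∑' y, (G.μ x y * f x ^ 2 + G.μ x y * f y ^ 2)
      = ∑ y ∈ s, (G.μ x y * f x ^ 2 + G.μ x y * f y ^ 2) :=
    tsum_eq_sum fun y hy => by rw [hz y hy]; ring
  have cs : (∑ y ∈ s, G.μ x y * (f y - f x)) ^ 2
      ≤ (∑ y ∈ s, G.μ x y) * ∑ y ∈ s, G.μ x y * (f y - f x) ^ 2 :=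
    Finset.sum_sq_le_sum_mul_sum_of_sq_le_mul s (fun y _ => G.μ_nonneg x y)
      (fun y _ => mul_nonneg (G.μ_nonneg x y) (sq_nonneg _)) (fun y _ => by
        rw [mul_pow, sq, mul_assoc])
  have b : ∑ y ∈ s, G.μ x y * (f y - f x) ^ 2
      ≤ 2 * ∑ y ∈ s, (G.μ x y * f x ^ 2 + G.μ x y * f y ^ 2) := by
    rw [Finset.mul_sum]
    refine Finset.sum_le_sum fun y _ => ?_
    have := mul_nonneg (G.μ_nonneg x y) (sq_nonneg (f y + f x))
    nlinarith
  have hm := G.m_pos x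
  have hd : 0 ≤ G.deg x / G.m x := div_nonneg (G.deg_nonneg x) hm.le
  rw [e3]
  refine le_trans ?_ (mul_le_mul_of_nonneg_left b hd)
  rw [laplacian, e1, e2]
  have : (1 / G.m x * ∑ y ∈ s, G.μ x y * (f y - f x)) ^ 2 * G.m x
      = (∑ y ∈ s, G.μ x y * (f y - f x)) ^ 2 / G.m x := by
    field_simp
  rw [this, div_mul_eq_mul_div]
  exact div_le_div_of_nonneg_right cs hm.le

theorem exists_deg_le (h : G.FiniteDm) : ∃ D : ℝ, 0 ≤ D ∧ ∀ x, G.deg x ≤ D * G.m x := by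
  obtain ⟨D, hD⟩ := h
  refine ⟨max D 0, le_max_right _ _, fun x => ?_⟩
  have h1 : G.deg x / G.m x ≤ D := hD ⟨x, rfl⟩
  exact (div_le_iff₀ (G.m_pos x)).1 (h1.trans (le_max_left _ _))

theorem laplacian_bound {D : ℝ} (hD0 : 0 ≤ D) (hD : ∀ x, G.deg x ≤ D * G.m x) (f : G.ell2) :
    (Summable fun x => G.laplacian f x ^ 2 * G.m x) ∧
      ∑' x, G.laplacian f x ^ 2 * G.m x ≤ (2 * D) ^ 2 * ∑' x, (f : V → ℝ) x ^ 2 * G.m x := by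
  have hf : Summable fun x => (f : V → ℝ) x ^ 2 * G.m x := G.summable_sq f
  generalize (f : V → ℝ) = g at hf ⊢
  have inner1 : ∀ x, ∑' y, G.μ x y * g x ^ 2 = G.deg x * g x ^ 2 := fun x => tsum_mul_right
  have hdeg : ∀ x, G.deg x * g x ^ 2 ≤ D * (g x ^ 2 * G.m x) := fun x => by
    have := mul_le_mul_of_nonneg_right (hD x) (sq_nonneg (g x))
    linarith
  have sdeg : Summable fun x => G.deg x * g x ^ 2 :=
    Summable.of_nonneg_of_le (fun x => mul_nonneg (G.deg_nonneg x) (sq_nonneg _)) hdeg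
      (hf.mul_left D)
  have s1 : Summable fun p : V × V => G.μ p.1 p.2 * g p.1 ^ 2 :=
    (summable_prod_of_nonneg (f := fun p : V × V => G.μ p.1 p.2 * g p.1 ^ 2)
      fun p => mul_nonneg (G.μ_nonneg p.1 p.2) (sq_nonneg (g p.1))).2
      ⟨fun x => (G.summable_μ x).mul_right (g x ^ 2), sdeg.congr fun x => (inner1 x).symm⟩
  have s2 : Summable fun p : V × V => G.μ p.1 p.2 * g p.2 ^ 2 := by
    refine ((Equiv.prodComm V V).summable_iff.2 s1).congr fun p => ?_
    simp [G.μ_symm p.1 p.2]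
  have t1 : ∑' p : V × V, G.μ p.1 p.2 * g p.1 ^ 2 = ∑' x, G.deg x * g x ^ 2 := by
    rw [s1.tsum_prod]
    exact tsum_congr inner1
  have t2 : ∑' p : V × V, G.μ p.1 p.2 * g p.2 ^ 2 = ∑' x, G.deg x * g x ^ 2 := by
    rw [← t1, ← (Equiv.prodComm V V).tsum_eq]
    exact tsum_congr fun p => by simp [G.μ_symm p.1 p.2]
  have s12 := s1.add s2
  have S : Summable fun x => ∑' y, (G.μ x y * g x ^ 2 + G.μ x y * g y ^ 2) := s12.prod
  have T : ∑' x, ∑' y, (G.μ x y * g x ^ 2 + G.μ x y * g y ^ 2)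
      = 2 * ∑' x, G.deg x * g x ^ 2 := by
    rw [← s12.tsum_prod, s1.tsum_add s2, t1, t2, two_mul]
  have key : ∀ x, G.laplacian g x ^ 2 * G.m x
      ≤ 2 * D * ∑' y, (G.μ x y * g x ^ 2 + G.μ x y * g y ^ 2) := fun x => by
    have h0 : 0 ≤ ∑' y, (G.μ x y * g x ^ 2 + G.μ x y * g y ^ 2) := tsum_nonneg fun y =>
      add_nonneg (mul_nonneg (G.μ_nonneg _ _) (sq_nonneg _))
        (mul_nonneg (G.μ_nonneg _ _) (sq_nonneg _))
    have h1 : G.deg x / G.m x ≤ D := (div_le_iff₀ (G.m_pos x)).2 (hD x)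
    have h2 := mul_le_mul_of_nonneg_right h1 (mul_nonneg zero_le_two h0)
    have h3 := G.sq_laplacian_le g x
    linarith
  have sL : Summable fun x => G.laplacian g x ^ 2 * G.m x :=
    Summable.of_nonneg_of_le (fun x => mul_nonneg (sq_nonneg _) (G.m_pos x).le) key
      (S.mul_left _)
  refine ⟨sL, ?_⟩
  have c1 := sL.tsum_le_tsum key (S.mul_left _)
  have c2 := sdeg.tsum_le_tsum hdeg (hf.mul_left D)
  rw [tsum_mul_left, T] at c1
  rw [tsum_mul_left] at c2
  have c3 := mul_le_mul_of_nonneg_left c2 (mul_nonneg (by norm_num : (0 : ℝ) ≤ 4) hD0)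
  nlinarith

theorem laplacian_add (f g : V → ℝ) (x : V) :
    G.laplacian (f + g) x = G.laplacian f x + G.laplacian g x := by
  simp only [laplacian]
  rw [← mul_add, ← (G.summable_μ_mul x fun y => f y - f x).tsum_add
    (G.summable_μ_mul x fun y => g y - g x)]
  congr 1
  exact tsum_congr fun y => by simp only [Pi.add_apply]; ring

theorem laplacian_smul (c : ℝ) (f : V → ℝ) (x : V) :
    G.laplacian (c • f) x = c * G.laplacian f x := by
  simp only [laplacian]
  rw [mul_left_comm, ← tsum_mul_left (a := c)]
  congr 1
  exact tsum_congr fun y => by simp only [Pi.smul_apply, smul_eq_mul]; ring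

/-- The restriction of `Δ` to `ℓ²(V, m)`; it maps `ℓ²(V, m)` to itself when `D_m < ∞`. -/
def laplacianLinear (h : G.FiniteDm) : G.ell2 →ₗ[ℝ] G.ell2 where
  toFun f := ⟨G.laplacian f,
    (G.laplacian_bound (G.exists_deg_le h).choose_spec.1 (G.exists_deg_le h).choose_spec.2 f).1⟩
  map_add' f g := Subtype.ext (funext fun x => G.laplacian_add f g x)
  map_smul' c f := Subtype.ext (funext fun x => G.laplacian_smul c f x)

/-- The graph Laplacian `Δ` as a bounded operator on `ℓ²(V, m)`, for `D_m < ∞`. -/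
def laplacianL2 (h : G.FiniteDm) : G.ell2 →L[ℝ] G.ell2 :=
  (G.laplacianLinear h).mkContinuous (2 * (G.exists_deg_le h).choose) fun f => by
    have hD := (G.exists_deg_le h).choose_spec
    refine abs_le_of_sq_le_sq' ?_ (mul_nonneg (mul_nonneg zero_le_two hD.1) (norm_nonneg _)) |>.2
    rw [mul_pow, norm_sq_ell2, norm_sq_ell2]
    exact (G.laplacian_bound hD.1 hD.2 f).2

theorem laplacianL2_apply (h : G.FiniteDm) (f : G.ell2) (x : V) :
    (G.laplacianL2 h f : V → ℝ) x = G.laplacian f x := rfl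

/-- The `ℓ²`-spectrum of the graph Laplacian, with the sign that makes it nonnegative, that is,
the spectrum of the bounded self-adjoint operator `-Δ` on `ℓ²(V, m)`. -/
def l2Spectrum (h : G.FiniteDm) : Set ℝ := spectrum ℝ (-G.laplacianL2 h)

end

end WeightedGraph

/-! The bottom of the spectrum is the largest lower bound of the Rayleigh quotient of `-Δ`. On a
finite graph the constants make it nonpositive. On an infinite graph, suppose that some `a > K n`
lies strictly below it. The resolvent at `a` then gives nonnegative Green functions; normalised at a
base vertex and with poles leaving every finite set, they converge by Harnack to a positive `u` on
`V` with `Δu = -a u` (`exists_pos_eigenfunction`).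

Such a `u` is excluded by a gradient estimate (`le_of_pos_eigenfunction`). With `f = √u` and `F =
Γ(f)/u`, the identity `2fΔf = Δ(f²) - 2Γ(f)` bounds `F`, and CDE where `F` nearly attains its
supremum `S` yields `a²/4 + aS ≤ nKS`, hence `a ≤ K n`. -/

/-! ### Bottom of the spectrum of a bounded symmetric operator. -/

/-- A bounded operator with `c ‖x‖² ≤ ⟪T x, x⟫` for some `c > 0` is invertible. -/
theorem ContinuousLinearMap.isUnit_of_pos_mul_sq_le_inner {E : Type*} [NormedAddCommGroup E]
    [InnerProductSpace ℝ E] [CompleteSpace E] (T : E →L[ℝ] E) {c : ℝ} (hc : 0 < c)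
    (h : ∀ x, c * ‖x‖ ^ 2 ≤ inner ℝ (T x) x) : IsUnit T := by
  refine T.isUnit_of_forall_le_norm_inner_map (c := ⟨c, hc.le⟩) hc fun x => ?_
  have h1 := (h x).trans (le_abs_self _)
  rw [Real.norm_eq_abs]
  change ‖x‖ ^ 2 * c ≤ _
  linarith

/-- A positive symmetric invertible operator is coercive. -/
theorem ContinuousLinearMap.exists_pos_mul_sq_le_inner_of_isUnit {E : Type*}
    [NormedAddCommGroup E] [InnerProductSpace ℝ E] (B : E →L[ℝ] E)
    (hs : ∀ x y, inner ℝ (B x) y = inner ℝ x (B y)) (hp : ∀ x, 0 ≤ inner ℝ (B x) x)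
    (hu : IsUnit B) : ∃ c : ℝ, 0 < c ∧ ∀ x, c * ‖x‖ ^ 2 ≤ inner ℝ (B x) x := by
  obtain ⟨u, rfl⟩ := hu
  set B : E →L[ℝ] E := u.val
  set A : E →L[ℝ] E := u.inv
  have hAB : ∀ x, A (B x) = x := fun x => by
    have : A * B = 1 := u.inv_val
    exact congrArg (fun T : E →L[ℝ] E => T x) this
  have hb : 0 < ‖B‖ + 1 := by positivity
  have ha : 0 < ‖A‖ + 1 := by positivity
  -- Expand the nonnegative form at `x - b⁻¹ B x` with `b = ‖B‖ + 1`, and bound its quadratic term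
  -- by `b ‖B x‖²`. The summand `1` makes `b` invertible even when `B = 0`.
  have key : ∀ x, ‖B x‖ ^ 2 ≤ (‖B‖ + 1) * inner ℝ (B x) x := fun x => by
    have h0 := hp (x - (‖B‖ + 1)⁻¹ • B x)
    have h1 : inner ℝ (B (B x)) (B x) ≤ (‖B‖ + 1) * ‖B x‖ ^ 2 :=
      calc inner ℝ (B (B x)) (B x) ≤ ‖B (B x)‖ * ‖B x‖ := real_inner_le_norm _ _
        _ ≤ (‖B‖ * ‖B x‖) * ‖B x‖ := by gcongr; exact B.le_opNorm _
        _ ≤ (‖B‖ + 1) * ‖B x‖ ^ 2 := by nlinarith [sq_nonneg ‖B x‖]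
    rw [map_sub, map_smul, inner_sub_left, inner_sub_right, inner_sub_right, inner_smul_left,
      inner_smul_left, inner_smul_right, inner_smul_right, hs (B x) x,
      real_inner_self_eq_norm_sq] at h0
    simp only [conj_trivial] at h0
    have h2 := mul_le_mul_of_nonneg_left h1 (by positivity : 0 ≤ (‖B‖ + 1)⁻¹)
    rw [inv_mul_cancel_left₀ hb.ne'] at h2
    have h3 := mul_le_mul_of_nonneg_left h2 (by positivity : 0 ≤ (‖B‖ + 1)⁻¹)
    have h4 : (‖B‖ + 1)⁻¹ * ‖B x‖ ^ 2 ≤ inner ℝ (B x) x := by linarith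
    rwa [inv_mul_le_iff₀ hb] at h4
  refine ⟨((‖A‖ + 1) ^ 2 * (‖B‖ + 1))⁻¹, by positivity, fun x => ?_⟩
  rw [inv_mul_le_iff₀ (by positivity)]
  have h1 : ‖x‖ ≤ (‖A‖ + 1) * ‖B x‖ := by
    have := A.le_opNorm (B x)
    rw [hAB] at this
    nlinarith [norm_nonneg (B x)]
  calc ‖x‖ ^ 2 ≤ ((‖A‖ + 1) * ‖B x‖) ^ 2 := by gcongr
    _ = (‖A‖ + 1) ^ 2 * ‖B x‖ ^ 2 := by ring
    _ ≤ (‖A‖ + 1) ^ 2 * ((‖B‖ + 1) * inner ℝ (B x) x) := by gcongr; exact key x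
    _ = _ := by ring

/-- The spectrum of a bounded symmetric operator on a nontrivial real Hilbert space has a greatest
lower bound, which is a lower bound of its quadratic form. -/
theorem ContinuousLinearMap.exists_isGLB_spectrum {E : Type*} [NormedAddCommGroup E]
    [InnerProductSpace ℝ E] [CompleteSpace E] [Nontrivial E] (T : E →L[ℝ] E)
    (hs : ∀ x y, inner ℝ (T x) y = inner ℝ x (T y)) :
    ∃ l : ℝ, IsGLB (spectrum ℝ T) l ∧ ∀ x, l * ‖x‖ ^ 2 ≤ inner ℝ (T x) x := by
  set S : Set ℝ := {a | ∀ x, a * ‖x‖ ^ 2 ≤ inner ℝ (T x) x} with hS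
  obtain ⟨e, he⟩ := exists_ne (0 : E)
  have hq : ∀ x : E, x ≠ 0 → ∀ a ∈ S, a ≤ inner ℝ (T x) x / ‖x‖ ^ 2 := fun x hx a ha => by
    have : 0 < ‖x‖ := norm_pos_iff.2 hx
    rw [le_div_iff₀ (by positivity)]
    exact ha x
  have hne : S.Nonempty := ⟨-‖T‖, fun x => by
    have h1 := (abs_le.1 (abs_real_inner_le_norm (T x) x)).1
    have h2 := mul_le_mul_of_nonneg_right (T.le_opNorm x) (norm_nonneg x)
    nlinarith⟩
  have hbdd : BddAbove S := ⟨_, hq e he⟩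
  have hl : sSup S ∈ S := fun x => by
    by_cases hx : x = 0
    · simp [hx]
    · have : 0 < ‖x‖ := norm_pos_iff.2 hx
      have h1 := csSup_le hne (hq x hx)
      rwa [le_div_iff₀ (by positivity)] at h1
  have hin : ∀ (a : ℝ) x, inner ℝ ((T - algebraMap ℝ (E →L[ℝ] E) a) x) x
      = inner ℝ (T x) x - a * ‖x‖ ^ 2 := fun a x => by
    rw [sub_apply, Algebra.algebraMap_eq_smul_one,
      smul_apply, one_apply_eq_self, inner_sub_left,
      inner_smul_left, real_inner_self_eq_norm_sq]
    simp
  have hspec : ∀ a, a ∈ spectrum ℝ T ↔ ¬ IsUnit (T - algebraMap ℝ (E →L[ℝ] E) a) := fun a => by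
    rw [spectrum.mem_iff, ← IsUnit.neg_iff, neg_sub]
  refine ⟨sSup S, ⟨fun a ha => ?_, fun b hb => hb ?_⟩, hl⟩
  · by_contra! hlt
    rw [hspec] at ha
    refine ha (isUnit_of_pos_mul_sq_le_inner _ (sub_pos.2 hlt) fun x => ?_)
    rw [hin]
    linarith [hl x]
  -- `sSup S` is itself in the spectrum: otherwise the nonnegative operator `T - sSup S` would be
  -- invertible, hence coercive, and `S` would contain a larger number.
  · rw [hspec]
    intro hu
    obtain ⟨c, hc, h⟩ := exists_pos_mul_sq_le_inner_of_isUnit _ (fun x y => by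
      simp only [sub_apply, Algebra.algebraMap_eq_smul_one,
        smul_apply, one_apply_eq_self, inner_sub_left,
        inner_sub_right, inner_smul_left, inner_smul_right, hs, conj_trivial]) (fun x => by
      rw [hin]; linarith [hl x]) hu
    have : sSup S + c ∈ S := fun x => by
      have := h x
      rw [hin] at this
      linarith
    linarith [le_csSup hbdd this]

namespace WeightedGraph

variable {V : Type*} (G : WeightedGraph V)

/-! ### Calculus of `Δ` and `Γ`, and the gradient estimate. -/

theorem m_mul_laplacian (f : V → ℝ) (x : V) :
    G.m x * G.laplacian f x = ∑' y, G.μ x y * f y - G.deg x * f x := by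
  rw [laplacian, ← mul_assoc, mul_one_div_cancel (G.m_pos x).ne', one_mul, deg, ← tsum_mul_right,
    ← (G.summable_μ_mul x f).tsum_sub (G.summable_μ_mul x fun _ => f x)]
  exact tsum_congr fun y => by ring

theorem neg_mul_le_laplacian {D : ℝ} (hD : ∀ x, G.deg x ≤ D * G.m x) {f : V → ℝ}
    (hf : ∀ x, 0 ≤ f x) (x : V) : -(D * f x) ≤ G.laplacian f x := by
  have h1 := G.m_mul_laplacian f x
  have h2 : 0 ≤ ∑' y, G.μ x y * f y := tsum_nonneg fun y => mul_nonneg (G.μ_nonneg x y) (hf y)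
  have h3 := mul_le_mul_of_nonneg_right (hD x) (hf x)
  have h4 : 0 ≤ G.m x * (G.laplacian f x + D * f x) := by linarith
  linarith [nonneg_of_mul_nonneg_right h4 (G.m_pos x)]

theorem gradForm_comm (f g : V → ℝ) (x : V) : G.gradForm f g x = G.gradForm g f x := by
  simp only [gradForm, mul_comm (f _) (g _)]
  ring

theorem gradForm_add_smul_right (f g h : V → ℝ) (a b : ℝ) (x : V) :
    G.gradForm f (fun y => a * g y + b * h y) x
      = a * G.gradForm f g x + b * G.gradForm f h x := by
  have e1 : (fun y => f y * (a * g y + b * h y))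
      = a • (fun y => f y * g y) + b • (fun y => f y * h y) := by
    ext y; simp only [Pi.add_apply, Pi.smul_apply, smul_eq_mul]; ring
  have e2 : (fun y => a * g y + b * h y) = a • g + b • h := rfl
  simp only [gradForm]
  rw [e1, e2]
  simp only [laplacian_add, laplacian_smul]
  ring

theorem gradForm_self (f : V → ℝ) (x : V) :
    G.gradForm f f x = 1 / (2 * G.m x) * ∑' y, G.μ x y * (f y - f x) ^ 2 := by
  have h : ∑' y, G.μ x y * (f y - f x) ^ 2 = ∑' y, G.μ x y * (f y * f y - f x * f x)
      - 2 * f x * ∑' y, G.μ x y * (f y - f x) := by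
    rw [← tsum_mul_left, ← (G.summable_μ_mul x fun y => f y * f y - f x * f x).tsum_sub
      ((G.summable_μ_mul x fun y => f y - f x).mul_left _)]
    exact tsum_congr fun y => by ring
  rw [h]
  simp only [gradForm, laplacian]
  have := (G.m_pos x).ne'
  field_simp
  ring

theorem gradForm_self_nonneg (f : V → ℝ) (x : V) : 0 ≤ G.gradForm f f x := by
  rw [gradForm_self]
  have := G.m_pos x
  exact mul_nonneg (by positivity)
    (tsum_nonneg fun y => mul_nonneg (G.μ_nonneg x y) (sq_nonneg _))

/-- If `f²` is an eigenfunction of `-Δ`, the left side of the curvature dimension inequality for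
`f` simplifies. -/
theorem gradForm₂_sub_of_laplacian_sq_eq {a : ℝ} {f : V → ℝ} (hf : ∀ x, 0 < f x)
    (h : ∀ x, G.laplacian (fun y => f y * f y) x = -a * (f x * f x)) (x : V) :
    G.gradForm₂ f f x - G.gradForm f (fun y => G.gradForm f f y / f y) x
      = 1 / 2 * G.laplacian (G.gradForm f f) x + a / 2 * G.gradForm f f x := by
  -- This is `2fΔf = Δ(f²) - 2Γ(f)` divided by `2f`. The term `Γ(f)/f` in `Δf` produces exactly what
  -- the correction in CDE cancels.
  have e : G.laplacian f = fun y => -(a / 2) * f y + (-1) * (G.gradForm f f y / f y) := by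
    ext y
    have h0 := (hf y).ne'
    simp only [gradForm, h y]
    field_simp
    ring
  have e2 : G.gradForm f (G.laplacian f) x = -(a / 2) * G.gradForm f f x
      + (-1) * G.gradForm f (fun y => G.gradForm f f y / f y) x := by
    conv_lhs => rw [e]
    exact G.gradForm_add_smul_right f f _ _ _ x
  rw [gradForm₂, G.gradForm_comm (G.laplacian f) f x, e2]
  ring

/-- The gradient estimate: a positive eigenfunction of `-Δ` on all of `V` with eigenvalue `a > 0`
satisfies `a ≤ K n`. -/
theorem le_of_pos_eigenfunction (hD : G.FiniteDm) {n K a : ℝ} (hn : 0 < n)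
    (hK : 0 ≤ K) (hCDE : G.CDE n (-K)) (ha : 0 < a) {u : V → ℝ} (hu : ∀ x, 0 < u x)
    (hΔ : ∀ x, G.laplacian u x = -a * u x) : a ≤ K * n := by
  obtain ⟨D, hD0, hD⟩ := G.exists_deg_le hD
  have : Nonempty V := G.connected.nonempty
  set f : V → ℝ := fun x => √(u x) with hfdef
  have hf : ∀ x, 0 < f x := fun x => Real.sqrt_pos.2 (hu x)
  have hff : ∀ x, f x * f x = u x := fun x => Real.mul_self_sqrt (hu x).le
  have hsq : ∀ x, G.laplacian (fun y => f y * f y) x = -a * (f x * f x) := fun x => by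
    simp only [hff, hΔ]
  set F : V → ℝ := fun x => G.gradForm f f x / u x with hF
  have hΓ : ∀ x, G.gradForm f f x = u x * F x := fun x => by
    simp only [hF]; rw [mul_div_cancel₀ _ (hu x).ne']
  have hF0 : ∀ x, 0 ≤ F x := fun x => div_nonneg (G.gradForm_self_nonneg f x) (hu x).le
  have hL : ∀ x, f x * G.laplacian f x = -(u x * (a / 2 + F x)) := fun x => by
    have h1 := hΓ x
    rw [gradForm, hsq x, hff] at h1
    linarith
  -- Positivity of `f` gives `Δf ≥ -D f`; multiplied by `f` and compared with `hL`, this bounds `a/2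
  -- + F`.
  have hFD : ∀ x, F x ≤ D := fun x => by
    have h1 := mul_le_mul_of_nonneg_left (G.neg_mul_le_laplacian hD (fun y => (hf y).le) x)
      (hf x).le
    rw [hL x] at h1
    have h2 : u x * (a / 2 + F x) ≤ u x * D := by rw [← hff x] at h1 ⊢; linarith
    linarith [le_of_mul_le_mul_left h2 (hu x)]
  have hbdd : BddAbove (Set.range F) := ⟨D, by rintro _ ⟨x, rfl⟩; exact hFD x⟩
  set S := ⨆ x, F x
  have hFS : ∀ x, F x ≤ S := le_ciSup hbdd
  have hS0 : 0 ≤ S := (hF0 this.some).trans (hFS _)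
  -- The supremum of `F` need not be attained, so the maximum principle is applied at an `ε`-almost
  -- maximum.
  have key : ∀ ε > 0, a ^ 2 / 4 + a * (S - ε) ≤ n * (1 / 2 * D * ε + K * S) := by
    intro ε hε
    obtain ⟨x, hx⟩ := exists_lt_of_lt_ciSup (show S - ε < ⨆ x, F x from sub_lt_self _ hε)
    have hneg : G.laplacian f x < 0 := by
      have h1 : 0 < u x * (a / 2 + F x) := mul_pos (hu x) (by linarith [hF0 x])
      by_contra! h2
      have h3 := mul_nonneg (hf x).le h2
      rw [hL x] at h3
      linarith
    have hC := hCDE x f hf hneg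
    rw [G.gradForm₂_sub_of_laplacian_sq_eq hf hsq x, hΓ x] at hC
    have hLsq : G.laplacian f x ^ 2 = u x * (a / 2 + F x) ^ 2 := by
      have h1 : u x * G.laplacian f x ^ 2 = u x * (u x * (a / 2 + F x) ^ 2) := by
        calc u x * G.laplacian f x ^ 2 = (f x * G.laplacian f x) ^ 2 := by
              rw [← hff x]; ring
          _ = _ := by rw [hL x]; ring
      exact mul_left_cancel₀ (hu x).ne' h1
    -- Since `Γ(f) = uF ≤ S u` at the neighbours, `ΔΓ(f)` is at most `S Δu` plus an error `deg/m · u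
    -- (S - F)`, which is at most `D u ε`.
    have hΔΓ : G.laplacian (G.gradForm f f) x ≤ u x * (-a * S + D * ε) := by
      have h1 := G.m_mul_laplacian (G.gradForm f f) x
      have h2 := G.m_mul_laplacian u x
      have h3 : ∑' y, G.μ x y * G.gradForm f f y ≤ ∑' y, S * (G.μ x y * u y) := by
        refine (G.summable_μ_mul x _).tsum_le_tsum (fun y => ?_)
          ((G.summable_μ_mul x _).mul_left S)
        rw [hΓ y]
        have := mul_le_mul_of_nonneg_left (hFS y) (mul_nonneg (G.μ_nonneg x y) (hu y).le)
        linarith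
      rw [tsum_mul_left] at h3
      rw [hΔ x] at h2
      rw [hΓ x] at h1
      have hux := hu x
      have h4 : G.deg x * (u x * (S - F x)) ≤ D * G.m x * (u x * ε) := by
        have h5 : u x * (S - F x) ≤ u x * ε := by gcongr; linarith
        have h6 : 0 ≤ u x * (S - F x) := mul_nonneg hux.le (by linarith [hFS x])
        have := G.m_pos x
        exact mul_le_mul (hD x) h5 h6 (by positivity)
      refine le_of_mul_le_mul_left ?_ (G.m_pos x)
      have h7 : S * (∑' y, G.μ x y * u y)
          = S * (G.m x * (-a * u x)) + S * (G.deg x * u x) := by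
        rw [h2]; ring
      linarith
    rw [hLsq] at hC
    have hC2 : u x * (1 / n * (a / 2 + F x) ^ 2)
        ≤ u x * (1 / 2 * D * ε + K * F x + a / 2 * (F x - S)) := by linarith
    have hC3 := le_of_mul_le_mul_left hC2 (hu x)
    have hC4 : 1 / n * (a / 2 + F x) ^ 2 ≤ 1 / 2 * D * ε + K * S := by
      have h1 := mul_le_mul_of_nonneg_left (hFS x) hK
      have h2 := mul_nonneg ha.le (sub_nonneg.2 (hFS x))
      linarith
    rw [one_div, inv_mul_le_iff₀ hn] at hC4
    have h1 := mul_lt_mul_of_pos_left hx ha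
    -- In `(a/2 + F)² = a²/4 + aF + F²` the last term is dropped and `F` is replaced by `S - ε`.
    linarith [sq_nonneg (F x)]
  by_contra! hlt
  have hlim : a ^ 2 / 4 + a * S ≤ n * (K * S) := by
    refine le_of_forall_pos_le_add fun δ hδ => ?_
    have hp : 0 < a + n * (1 / 2 * D) + 1 := by positivity
    have := key (δ / (a + n * (1 / 2 * D) + 1)) (by positivity)
    have h2 : δ / (a + n * (1 / 2 * D) + 1) * (a + n * (1 / 2 * D)) ≤ δ := by
      rw [div_mul_eq_mul_div, div_le_iff₀ hp]
      nlinarith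
    linarith
  nlinarith [mul_le_mul_of_nonneg_right hlt.le hS0, pow_pos ha 2]

open Filter Topology

/-! ### Completeness of `ℓ²(V, m)` and symmetry of `Δ`. -/

theorem memℓp_mul_sqrt (f : G.ell2) :
    Memℓp (fun x => (f : V → ℝ) x * √(G.m x)) 2 := by
  rw [memℓp_gen_iff (by norm_num)]
  refine (G.summable_sq f).congr fun x => ?_
  simp only [ENNReal.toReal_ofNat, Real.rpow_ofNat, Real.norm_eq_abs, sq_abs, mul_pow,
    Real.sq_sqrt (G.m_pos x).le]

/-- The isometric isomorphism of `ℓ²(V, m)` with the unweighted `ℓ²(V)`. -/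
noncomputable def ell2Equiv : G.ell2 ≃ₗᵢ[ℝ] lp (fun _ : V => ℝ) 2 where
  toFun f := ⟨fun x => (f : V → ℝ) x * √(G.m x), G.memℓp_mul_sqrt f⟩
  map_add' f g := by
    ext x
    simp only [ell2_coe_add, Pi.add_apply, add_mul, lp.coeFn_add]
  map_smul' c f := by
    ext x
    simp only [ell2_coe_smul, Pi.smul_apply, smul_eq_mul, lp.coeFn_smul, RingHom.id_apply,
      mul_assoc]
  invFun g := ⟨fun x => g x / √(G.m x), by
    refine ((memℓp_gen_iff (by norm_num)).1 g.2).congr fun x => ?_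
    simp only [ENNReal.toReal_ofNat, Real.rpow_ofNat, Real.norm_eq_abs, sq_abs, div_pow,
      Real.sq_sqrt (G.m_pos x).le, div_mul_cancel₀ _ (G.m_pos x).ne']⟩
  left_inv f := Subtype.ext (funext fun x =>
    mul_div_cancel_right₀ _ (Real.sqrt_pos.2 (G.m_pos x)).ne')
  right_inv g := by
    ext x
    exact div_mul_cancel₀ _ (Real.sqrt_pos.2 (G.m_pos x)).ne'
  norm_map' f := by
    rw [← sq_eq_sq₀ (norm_nonneg _) (norm_nonneg _), norm_sq_ell2, ← real_inner_self_eq_norm_sq,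
      lp.inner_eq_tsum]
    refine tsum_congr fun x => ?_
    change (f : V → ℝ) x * √(G.m x) * ((f : V → ℝ) x * √(G.m x)) = _
    rw [mul_mul_mul_comm, Real.mul_self_sqrt (G.m_pos x).le, sq]

instance : CompleteSpace G.ell2 := G.ell2Equiv.toIsometryEquiv.completeSpace

theorem inner_ell2 (f g : G.ell2) :
    inner ℝ f g = ∑' x, (f : V → ℝ) x * (g : V → ℝ) x * G.m x := rfl

theorem summable_deg_mul_sq (hD : G.FiniteDm) (f : G.ell2) :
    Summable fun x => G.deg x * (f : V → ℝ) x ^ 2 := by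
  obtain ⟨D, -, hD⟩ := G.exists_deg_le hD
  refine Summable.of_nonneg_of_le (fun x => mul_nonneg (G.deg_nonneg x) (sq_nonneg _))
    (fun x => ?_) ((G.summable_sq f).mul_left D)
  have := mul_le_mul_of_nonneg_right (hD x) (sq_nonneg ((f : V → ℝ) x))
  linarith

theorem summable_μ_mul_sq_fst {g : V → ℝ} (hg : Summable fun x => G.deg x * g x ^ 2) :
    Summable fun p : V × V => G.μ p.1 p.2 * g p.1 ^ 2 :=
  (summable_prod_of_nonneg (f := fun p : V × V => G.μ p.1 p.2 * g p.1 ^ 2)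
    fun p => mul_nonneg (G.μ_nonneg p.1 p.2) (sq_nonneg (g p.1))).2
    ⟨fun x => (G.summable_μ x).mul_right (g x ^ 2), hg.congr fun _ => tsum_mul_right.symm⟩

/-- Follows from `|st| ≤ s² + t²` and the symmetry of `μ`; it justifies Fubini for the double sum in
`inner_laplacianL2`. -/
theorem summable_μ_mul_mul (hD : G.FiniteDm) (f g : G.ell2) :
    Summable fun p : V × V => G.μ p.1 p.2 * ((f : V → ℝ) p.1 * (g : V → ℝ) p.2) := by
  have h2 : Summable fun p : V × V => G.μ p.1 p.2 * (g : V → ℝ) p.2 ^ 2 := by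
    refine ((Equiv.prodComm V V).summable_iff.2 (G.summable_μ_mul_sq_fst
      (G.summable_deg_mul_sq hD g))).congr fun p => ?_
    simp [G.μ_symm p.1 p.2]
  refine Summable.of_norm_bounded ((G.summable_μ_mul_sq_fst
    (G.summable_deg_mul_sq hD f)).add h2) fun p => ?_
  rw [norm_mul, Real.norm_of_nonneg (G.μ_nonneg _ _), ← mul_add, Real.norm_eq_abs, abs_mul]
  refine mul_le_mul_of_nonneg_left ?_ (G.μ_nonneg _ _)
  rw [← sq_abs ((f : V → ℝ) p.1), ← sq_abs ((g : V → ℝ) p.2)]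
  nlinarith [sq_nonneg (|(f : V → ℝ) p.1| - |(g : V → ℝ) p.2|),
    sq_nonneg (|(f : V → ℝ) p.1| + |(g : V → ℝ) p.2|)]

/-- In this form symmetry is visible: exchanging `f` and `g` amounts to swapping the two vertices in
the double sum. -/
theorem inner_laplacianL2 (hD : G.FiniteDm) (f g : G.ell2) :
    inner ℝ (G.laplacianL2 hD f) g = ∑' p : V × V, G.μ p.1 p.2 *
      ((g : V → ℝ) p.1 * (f : V → ℝ) p.2) - ∑' x, G.deg x * ((f : V → ℝ) x * (g : V → ℝ) x) := by
  have hs := G.summable_μ_mul_mul hD g f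
  have hp : ∀ x, (G.laplacianL2 hD f : V → ℝ) x * (g : V → ℝ) x * G.m x
      = ∑' y, G.μ x y * ((g : V → ℝ) x * (f : V → ℝ) y)
        - G.deg x * ((f : V → ℝ) x * (g : V → ℝ) x) := fun x => by
    have h1 : ∑' y, G.μ x y * ((g : V → ℝ) x * (f : V → ℝ) y)
        = (g : V → ℝ) x * ∑' y, G.μ x y * (f : V → ℝ) y := by
      rw [← tsum_mul_left]
      exact tsum_congr fun y => by ring
    have h2 := G.m_mul_laplacian f x
    rw [h1, laplacianL2_apply, sub_eq_iff_eq_add.1 h2.symm]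
    ring
  have hd : Summable fun x => G.deg x * ((f : V → ℝ) x * (g : V → ℝ) x) := by
    refine (hs.prod.sub (G.summable_mul (G.laplacianL2 hD f) g)).congr fun x => ?_
    rw [hp x]
    ring
  rw [inner_ell2, hs.tsum_prod, ← hs.prod.tsum_sub hd]
  exact tsum_congr hp

/-- The Laplacian on `ℓ²(V, m)` is symmetric. -/
theorem inner_laplacianL2_left (hD : G.FiniteDm) (f g : G.ell2) :
    inner ℝ (G.laplacianL2 hD f) g = inner ℝ f (G.laplacianL2 hD g) := by
  rw [real_inner_comm (G.laplacianL2 hD g) f, inner_laplacianL2, inner_laplacianL2,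
    ← (Equiv.prodComm V V).tsum_eq]
  congr 1
  · exact tsum_congr fun p => by simp [G.μ_symm p.1 p.2, mul_comm]
  · exact tsum_congr fun x => by ring

theorem exists_ell2_single [DecidableEq V] (o : V) :
    ∃ f : G.ell2, (f : V → ℝ) = Pi.single o 1 := by
  refine ⟨⟨Pi.single o 1, ?_⟩, rfl⟩
  refine summable_of_hasFiniteSupport ((Set.finite_singleton o).subset fun x hx => ?_)
  by_contra h
  exact hx (by simp [Pi.single_eq_of_ne h])

instance : Nontrivial G.ell2 := by
  classical
  obtain ⟨o⟩ := G.connected.nonempty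
  obtain ⟨f, hf⟩ := G.exists_ell2_single o
  refine ⟨f, 0, fun h => ?_⟩
  have h1 : (0 : V → ℝ) = Pi.single o 1 := by rw [← hf, h]; rfl
  simpa using congrFun h1 o

/-! ### Green functions, Harnack inequality and positive eigenfunctions. -/

/-- Below the spectrum of `-Δ` there is a nonnegative Green function at every vertex. -/
theorem exists_green_function (hD : G.FiniteDm) {a c : ℝ} (hc : 0 < c)
    (h : ∀ f : G.ell2, (a + c) * ‖f‖ ^ 2 ≤ inner ℝ ((-G.laplacianL2 hD) f) f) (o : V) :
    ∃ g : V → ℝ, (∀ x, 0 ≤ g x) ∧ 0 < g o ∧ (∀ x, G.laplacian g x ≤ -a * g x) ∧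
      ∀ x, x ≠ o → G.laplacian g x = -a * g x := by
  classical
  obtain ⟨d, hd⟩ := G.exists_ell2_single o
  have hu : IsUnit (-G.laplacianL2 hD - a • (1 : G.ell2 →L[ℝ] G.ell2)) := by
    refine ContinuousLinearMap.isUnit_of_pos_mul_sq_le_inner _ hc fun f => ?_
    have := h f
    rw [sub_apply, inner_sub_left, smul_apply, one_apply_eq_self, inner_smul_left,
      real_inner_self_eq_norm_sq, conj_trivial]
    linarith
  obtain ⟨g, hg⟩ := (ContinuousLinearMap.isUnit_iff_bijective.1 hu).2 d
  have hΔ : ∀ x, G.laplacian g x = -a * (g : V → ℝ) x - (Pi.single o 1 : V → ℝ) x := fun x => by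
    have h1 : -G.laplacian g x - a * (g : V → ℝ) x = (Pi.single o 1 : V → ℝ) x := by
      rw [← hd, ← hg]; rfl
    linarith
  have hle : ∀ x, G.laplacian g x ≤ -a * (g : V → ℝ) x := fun x => by
    have : (0 : V → ℝ) x ≤ (Pi.single o 1 : V → ℝ) x :=
      (Pi.single_nonneg (i := o)).2 (zero_le_one (α := ℝ)) x
    rw [hΔ x]
    simpa using this
  have hmax : ∀ t : ℝ, max (-t) 0 ^ 2 ≤ t ^ 2 := fun t => by
    rcases max_cases (-t) 0 with h | h <;> rw [h.1]
    · rw [neg_sq]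
    · rw [zero_pow two_ne_zero]; positivity
  have hpmem : (fun x => max (-(g : V → ℝ) x) 0) ∈ G.ell2Submodule :=
    Summable.of_nonneg_of_le (fun x => mul_nonneg (sq_nonneg _) (G.m_pos x).le)
      (fun x => mul_le_mul_of_nonneg_right (hmax _) (G.m_pos x).le) (G.summable_sq g)
  set p : G.ell2 := ⟨_, hpmem⟩ with hp
  have hpv : ∀ x, (p : V → ℝ) x = max (-(g : V → ℝ) x) 0 := fun x => rfl
  -- With `p` the negative part of `g`: where `p = -g`, the inequality `p ≥ -g` elsewhere gives `-Δp
  -- ≤ Δg ≤ -a g = a p`. Summed, this contradicts the form bound with `a + c` unless `p = 0`.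
  have hpt : ∀ x, -G.laplacian p x * (p : V → ℝ) x ≤ a * (p : V → ℝ) x ^ 2 := fun x => by
    rcases max_cases (-(g : V → ℝ) x) 0 with h | h <;> rw [← hpv] at h
    · have h1 := G.m_mul_laplacian p x
      have h2 := G.m_mul_laplacian g x
      have h3 : ∑' y, G.μ x y * -(g : V → ℝ) y ≤ ∑' y, G.μ x y * (p : V → ℝ) y :=
        (G.summable_μ_mul x _).tsum_le_tsum (fun y => mul_le_mul_of_nonneg_left
          (le_max_left _ _) (G.μ_nonneg x y)) (G.summable_μ_mul x _)
      simp only [mul_neg, tsum_neg] at h3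
      rw [h.1] at h1 ⊢
      have h4 : -G.laplacian g x ≤ G.laplacian p x :=
        le_of_mul_le_mul_left (by linarith) (G.m_pos x)
      have h5 := hle x
      nlinarith
    · rw [h.1]; simp
  have hp0 : p = 0 := by
    have h1 := h p
    have h2 : inner ℝ ((-G.laplacianL2 hD) p) p ≤ a * ‖p‖ ^ 2 := by
      rw [inner_ell2, norm_sq_ell2, ← tsum_mul_left]
      refine (G.summable_mul _ p).tsum_le_tsum (fun x => ?_) ((G.summable_sq p).mul_left a)
      have := mul_le_mul_of_nonneg_right (hpt x) (G.m_pos x).le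
      rw [← mul_assoc]
      exact this
    have h3 : ‖p‖ ^ 2 ≤ 0 := by nlinarith
    exact norm_eq_zero.1 (pow_eq_zero_iff two_ne_zero |>.1 (le_antisymm h3 (sq_nonneg _)))
  have hg0 : ∀ x, 0 ≤ (g : V → ℝ) x := fun x => by
    have h1 : (p : V → ℝ) x = 0 := by rw [hp0]; rfl
    rw [hpv] at h1
    linarith [le_max_left (-(g : V → ℝ) x) 0]
  refine ⟨g, hg0, (hg0 o).lt_of_ne' fun h0 => ?_, hle, fun x hx => ?_⟩
  -- If `g o = 0`, then `Δg(o) ≥ 0` because `g ≥ 0`, whereas the equation gives `Δg(o) = -1`.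
  · have h1 := G.m_mul_laplacian g o
    have h2 : 0 ≤ ∑' y, G.μ o y * (g : V → ℝ) y :=
      tsum_nonneg fun y => mul_nonneg (G.μ_nonneg o y) (hg0 y)
    rw [hΔ o, h0, Pi.single_eq_same] at h1
    linarith [G.m_pos o]
  · rw [hΔ x, Pi.single_eq_of_ne hx, sub_zero]

/-- Harnack inequality: nonnegative supersolutions are comparable at any two vertices, uniformly
in the supersolution. -/
theorem exists_harnack_const (a : ℝ) (x y : V) :
    ∃ C : ℝ, 0 ≤ C ∧ ∀ g : V → ℝ, (∀ z, 0 ≤ g z) → (∀ z, G.laplacian g z ≤ -a * g z) →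
      g y ≤ C * g x := by
  have hr : Relation.ReflTransGen G.graph.Adj x y :=
    (SimpleGraph.reachable_iff_reflTransGen x y).1 (G.connected.preconnected x y)
  induction hr with
  | refl => exact ⟨1, zero_le_one, fun g _ _ => by rw [one_mul]⟩
  | @tail y z _ hyz ih =>
    obtain ⟨C, hC0, hC⟩ := ih
    have hμ := (G.μ_pos_iff y z).2 hyz
    -- One edge: the supersolution inequality at `y` gives `μ_yz g(z) ≤ (deg y - a m(y)) g(y)`. The
    -- absolute value keeps the constant nonnegative for every `a`.
    refine ⟨|G.deg y - a * G.m y| / G.μ y z * C, by positivity, fun g hg0 hg => ?_⟩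
    have h1 := G.m_mul_laplacian g y
    have h2 : G.μ y z * g z ≤ ∑' w, G.μ y w * g w :=
      (G.summable_μ_mul y g).le_tsum z fun w _ => mul_nonneg (G.μ_nonneg y w) (hg0 w)
    have h3 := mul_le_mul_of_nonneg_left (hg y) (G.m_pos y).le
    have h4 := mul_le_mul_of_nonneg_right (le_abs_self (G.deg y - a * G.m y)) (hg0 y)
    have h5 := mul_le_mul_of_nonneg_left (hC g hg0 hg) (abs_nonneg (G.deg y - a * G.m y))
    rw [div_mul_eq_mul_div, div_mul_eq_mul_div, le_div_iff₀ hμ]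
    linarith

/-- By local finiteness `Δ` at a vertex is a finite sum, so pointwise convergence suffices. -/
theorem tendsto_laplacian {ι : Type*} {l : Filter ι} {v : ι → V → ℝ} {u : V → ℝ}
    (h : ∀ y, Tendsto (fun i => v i y) l (𝓝 (u y))) (x : V) :
    Tendsto (fun i => G.laplacian (v i) x) l (𝓝 (G.laplacian u x)) := by
  have e : ∀ f : V → ℝ, G.laplacian f x
      = 1 / G.m x * ∑ y ∈ (G.support_μ_finite x).toFinset, G.μ x y * (f y - f x) := fun f => by
    rw [laplacian]
    congr 1
    refine tsum_eq_sum fun y hy => ?_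
    have : G.μ x y = 0 := by simpa using hy
    rw [this, zero_mul]
  simp only [e]
  exact (tendsto_finsetSum _ fun y _ => ((h y).sub (h x)).const_mul _).const_mul _

/-- On an infinite graph, every number below the spectrum of `-Δ` has a positive eigenfunction
on all of `V`. -/
theorem exists_pos_eigenfunction [Infinite V] (hD : G.FiniteDm) {a c : ℝ} (hc : 0 < c)
    (h : ∀ f : G.ell2, (a + c) * ‖f‖ ^ 2 ≤ inner ℝ ((-G.laplacianL2 hD) f) f) :
    ∃ u : V → ℝ, (∀ x, 0 < u x) ∧ ∀ x, G.laplacian u x = -a * u x := by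
  obtain ⟨o⟩ := G.connected.nonempty
  choose g hg0 hgpos hgle hgeq using G.exists_green_function hD hc h
  have hgo : ∀ i, 0 < g i o := fun i => (hg0 i o).lt_of_ne' fun h0 => by
    obtain ⟨C, -, hC⟩ := G.exists_harnack_const a o i
    have := hC (g i) (hg0 i) (hgle i)
    rw [h0, mul_zero] at this
    exact absurd (hgpos i) this.not_gt
  set v : V → V → ℝ := fun i => (g i o)⁻¹ • g i
  have hv0 : ∀ i x, 0 ≤ v i x := fun i x => mul_nonneg (inv_nonneg.2 (hgo i).le) (hg0 i x)
  have hvo : ∀ i, v i o = 1 := fun i => inv_mul_cancel₀ (hgo i).ne'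
  have hvle : ∀ i x, G.laplacian (v i) x ≤ -a * v i x := fun i x => by
    have := mul_le_mul_of_nonneg_left (hgle i x) (inv_nonneg.2 (hgo i).le)
    rw [laplacian_smul]
    simp only [v, Pi.smul_apply, smul_eq_mul]
    linarith
  have hveq : ∀ i x, x ≠ i → G.laplacian (v i) x = -a * v i x := fun i x hx => by
    rw [laplacian_smul, hgeq i x hx]
    simp only [v, Pi.smul_apply, smul_eq_mul]
    ring
  -- Harnack confines the values at `y` to a compact interval independent of the pole; an
  -- ultrafilter then gives limits at all vertices at once, without extracting subsequences.
  have hlim : ∀ y, ∃ t, Tendsto (fun i => v i y) (hyperfilter V) (𝓝 t) := fun y => by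
    obtain ⟨C, -, hC⟩ := G.exists_harnack_const a o y
    have hmem : ∀ i, v i y ∈ Set.Icc 0 C := fun i =>
      ⟨hv0 i y, by simpa [hvo] using hC (v i) (hv0 i) (hvle i)⟩
    obtain ⟨t, -, ht⟩ := isCompact_Icc.ultrafilter_le_nhds ((hyperfilter V).map fun i => v i y)
      (le_principal_iff.2 (Filter.mem_map.2 (univ_mem' hmem)))
    exact ⟨t, ht⟩
  choose u hu using hlim
  have hu0 : ∀ x, 0 ≤ u x := fun x => ge_of_tendsto' (hu x) fun i => hv0 i x
  have huo : u o = 1 := tendsto_nhds_unique (hu o) (by simp [hvo])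
  have hΔ : ∀ x, G.laplacian u x = -a * u x := fun x => by
    refine tendsto_nhds_unique (G.tendsto_laplacian hu x) (((hu x).const_mul (-a)).congr' ?_)
    -- The ultrafilter is nonprincipal as `V` is infinite, so the pole eventually avoids `x` and the
    -- limit equation has no source.
    have : ∀ᶠ i in (hyperfilter V : Filter V), i ≠ x :=
      compl_mem_hyperfilter_of_finite (Set.finite_singleton x)
    exact this.mono fun i hi => (hveq i x hi.symm).symm
  refine ⟨u, fun x => (hu0 x).lt_of_ne' fun h0 => ?_, hΔ⟩
  -- By Harnack a zero of `u` would force `u o = 0`, against the normalisation `u o = 1`.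
  obtain ⟨C, -, hC⟩ := G.exists_harnack_const a x o
  have := hC u hu0 fun z => (hΔ z).le
  rw [h0, huo] at this
  linarith

/-- On a finite graph the quadratic form of `-Δ` has no positive lower bound. -/
theorem nonpos_of_forall_mul_sq_le [Finite V] (hD : G.FiniteDm) {a : ℝ}
    (h : ∀ f : G.ell2, a * ‖f‖ ^ 2 ≤ inner ℝ ((-G.laplacianL2 hD) f) f) : a ≤ 0 := by
  set f : G.ell2 := ⟨fun _ => 1, Summable.of_finite⟩ with hf
  have h0 : (-G.laplacianL2 hD) f = 0 := by
    refine Subtype.ext (funext fun x => ?_)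
    change -G.laplacian (fun _ => 1) x = 0
    simp [laplacian]
  have hpos : 0 < ‖f‖ ^ 2 := by
    obtain ⟨o⟩ := G.connected.nonempty
    have : f ≠ 0 := fun h => by
      have h1 : (fun _ => 1 : V → ℝ) = 0 := congrArg Subtype.val h
      exact one_ne_zero (congrFun h1 o)
    have := norm_pos_iff.2 this
    positivity
  have := h f
  rw [h0, inner_zero_left] at this
  nlinarith

end WeightedGraph

/-! ### Cheng's estimate. -/

theorem mainTheorem5 {V : Type*} (G : WeightedGraph V) (hD : G.FiniteDm) (n K : ℝ)
    (hn : 0 < n) (hK : 0 ≤ K) (hCDE : G.CDE n (-K)) :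
    ∃ μ : ℝ, IsGLB (G.l2Spectrum hD) μ ∧ μ ≤ K * n := by
  obtain ⟨l, hl, hle⟩ := ContinuousLinearMap.exists_isGLB_spectrum (-G.laplacianL2 hD)
    fun f g => by
      simp only [neg_apply, inner_neg_left, inner_neg_right, G.inner_laplacianL2_left hD f g]
  refine ⟨l, hl, ?_⟩
  rcases finite_or_infinite V with hV | hV
  · exact (G.nonpos_of_forall_mul_sq_le hD hle).trans (by positivity)
  · by_contra! hlt
    obtain ⟨a, ha1, ha2⟩ := exists_between hlt
    -- The spectral gap is `c = l - a`, positive because `a` lies strictly below `l`.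
    obtain ⟨u, hu, hΔ⟩ := G.exists_pos_eigenfunction hD (a := a) (sub_pos.2 ha2)
      (by simpa using hle)
    have ha : 0 < a := (by positivity : 0 ≤ K * n).trans_lt ha1
    exact absurd (G.le_of_pos_eigenfunction hD hn hK hCDE ha hu hΔ) ha1.not_ge
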